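/- Corollary (Value Iteration). Let $U\subset\mathbb{R}^{m}$ and $D\subset\mathbb{R}^{p}$ be non-empty compact sets and let $f:\mathbb{R}^n\times U\times D\to\mathbb{R}^n$ be bounded, uniformly continuous, and Lipschitz continuous in $x\in\mathbb{R}^n$ with a constant that does not depend on $(u,d)\in U\times D$. Let $h_S:\mathbb{R}^n\to\mathbb{R}$ be bounded and uniformly continuous, and let $\gamma>0$. Let $\mathcal{U}^-$ and $\mathcal{D}^-$ be the sets of Lebesgue measurable functions $(-\infty,0]\to U$ and $(-\infty,0]\to D$, respectively. Let $\Xi_d^-$ be the set of non-anticipative strategies, i.e. of maps $\xi:\mathcal{U}^-\to\mathcal{D}^-$ such that for all $s\le 0$ and $\mathrm{u},\bar{\mathrm{u}}\in\mathcal{U}^-$: if $\mathrm{u}=\bar{\mathrm{u}}$ a.e. on $[s,0]$, then $\xi[\mathrm{u}]=\xi[\bar{\mathrm{u}}]$ a.e. on $[s,0]$. For $x\in\mathbb{R}^n$, $\mathrm{u}\in\mathcal{U}^-$ and $\xi\in\Xi_d^-$ let $\mathrm{x}^-:(-\infty,0]\to\mathbb{R}^n$ be the (Carathéodory) solution of $$\dot{\mathrm{x}}^-(t)=f(\mathrm{x}^-(t),\mathrm{u}(t),\xi[\mathrm{u}](t))\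 \text{ for } t<0,\qquad \mathrm{x}^-(0)=x.$$ Define $$V_\gamma(x)=\sup_{\xi\in\Xi_d^-}\ \inf_{\mathrm{u}\in\mathcal{U}^-}\ \sup_{t\le 0}\, e^{\gamma t}h_S(\mathrm{x}^-(t)),$$ and, for $T>0$ and $V$ in the set $\mathrm{BUC}(\mathbb{R}^n)$ of bounded uniformly continuous functions $\mathbb{R}^n\to\mathbb{R}$, $$B_T[V](x)=\sup_{\xi\in\Xi_d^-}\ \inf_{\mathrm{u}\in\mathcal{U}^-}\ \max\Big\{\max_{t\in[-T,0]}e^{\gamma t}h_S(\mathrm{x}^-(t)),\ e^{-\gamma T}V(\mathrm{x}^-(-T))\Big\}.$$ Let $V^0\in\mathrm{BUC}(\mathbb{R}^n)$ and $\Delta t>0$, and define $V^k=B_{\Delta t}[V^{k-1}]$ for $k\ge 1$. Then $V_\gamma$ and all $V^k$ belong to $\mathrm{BUC}(\mathbb{R}^n)$, $$\lVert V^{k+1}-V_\gamma\rVert_\infty\ \le\ e^{-\gamma\Delta t}\,\lVert V^{k}-V_\gamma\rVert_\infty\quad\text{for all } k\ge 0,\qquad e^{-\gamma\Delta t}<1,$$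 and consequently $\lVert V^k-V_\gamma\rVert_\infty\to 0$ as $k\to\infty$. -/

import Mathlib

open MeasureTheory Set Filter Topology
open scoped NNReal

namespace FRT

/-- Lebesgue measurable signals on the backward time axis `(-∞, 0]` with values in `A`.
A signal is a total function on `ℝ`; only its values at times `t ≤ 0` are constrained, and only
those are ever used. For a map into a Euclidean space, `AEMeasurable` with respect to Lebesgue
measure is the same as Lebesgue measurability. -/
def BackwardSignal {m : ℕ} (A : Set (EuclideanSpace ℝ (Fin m))) :
    Set (ℝ → EuclideanSpace ℝ (Fin m)) :=
  {u | AEMeasurable u (volume.restrict (Iic 0)) ∧ ∀ t ≤ 0, u t ∈ A}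

/-- Non-anticipative (backward in time) disturbance strategies. -/
def BackwardStrategy {m p : ℕ} (U : Set (EuclideanSpace ℝ (Fin m)))
    (D : Set (EuclideanSpace ℝ (Fin p))) : Set (BackwardSignal U → BackwardSignal D) :=
  {ξ | ∀ s ≤ (0 : ℝ), ∀ u v : BackwardSignal U,
    (∀ᵐ τ ∂(volume.restrict (Icc s 0)), u.1 τ = v.1 τ) →
      ∀ᵐ τ ∂(volume.restrict (Icc s 0)), (ξ u).1 τ = (ξ v).1 τ}

/-- Standing assumptions on the vector field `f : ℝⁿ × U × D → ℝⁿ`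
(the values of `f` outside `ℝⁿ × U × D` are irrelevant). -/
structure DynamicsAssumption {n m p : ℕ}
    (f : EuclideanSpace ℝ (Fin n) → EuclideanSpace ℝ (Fin m) → EuclideanSpace ℝ (Fin p) →
      EuclideanSpace ℝ (Fin n))
    (U : Set (EuclideanSpace ℝ (Fin m))) (D : Set (EuclideanSpace ℝ (Fin p))) : Prop where
  uniformContinuous : UniformContinuousOn
    (fun q : EuclideanSpace ℝ (Fin n) × EuclideanSpace ℝ (Fin m) × EuclideanSpace ℝ (Fin p) =>
      f q.1 q.2.1 q.2.2) (univ ×ˢ U ×ˢ D)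
  lipschitz : ∃ L : ℝ≥0, ∀ u ∈ U, ∀ d ∈ D, LipschitzWith L (fun x => f x u d)
  bounded : ∃ M > (0 : ℝ), ∀ x, ∀ u ∈ U, ∀ d ∈ D, ‖f x u d‖ ≤ M

/-- `x` is a (Carathéodory) solution on `(-∞, 0]` of `x'(t) = f (x t) (u t) (d t)` with terminal
state `x 0 = x₀`. For `t ≤ 0` the interval integral from `0` to `t` is minus the integral over
`[t, 0]`. -/
def IsBackwardTrajectory {n m p : ℕ}
    (f : EuclideanSpace ℝ (Fin n) → EuclideanSpace ℝ (Fin m) → EuclideanSpace ℝ (Fin p) →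
      EuclideanSpace ℝ (Fin n))
    (u : ℝ → EuclideanSpace ℝ (Fin m)) (d : ℝ → EuclideanSpace ℝ (Fin p))
    (x₀ : EuclideanSpace ℝ (Fin n)) (x : ℝ → EuclideanSpace ℝ (Fin n)) : Prop :=
  ContinuousOn x (Iic 0) ∧
    ∀ t ≤ (0 : ℝ), IntervalIntegrable (fun s => f (x s) (u s) (d s)) volume 0 t ∧
      x t = x₀ + ∫ s in (0 : ℝ)..t, f (x s) (u s) (d s)

/-- The backward trajectory with terminal state `x₀`. Under `DynamicsAssumption` it exists and is
unique on `(-∞, 0]` for all signals `u`, `d` with values in `U`, `D`. -/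
noncomputable def backwardTrajectory {n m p : ℕ}
    (f : EuclideanSpace ℝ (Fin n) → EuclideanSpace ℝ (Fin m) → EuclideanSpace ℝ (Fin p) →
      EuclideanSpace ℝ (Fin n))
    (u : ℝ → EuclideanSpace ℝ (Fin m)) (d : ℝ → EuclideanSpace ℝ (Fin p))
    (x₀ : EuclideanSpace ℝ (Fin n)) : ℝ → EuclideanSpace ℝ (Fin n) :=
  Classical.epsilon (IsBackwardTrajectory f u d x₀)

/-- The FRT value function `V_γ`: `sup` over strategies, `inf` over controls, of
`sup_{t ≤ 0} e^{γ t} h (x⁻ t)`. -/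
noncomputable def valueFunction {n m p : ℕ}
    (f : EuclideanSpace ℝ (Fin n) → EuclideanSpace ℝ (Fin m) → EuclideanSpace ℝ (Fin p) →
      EuclideanSpace ℝ (Fin n))
    (U : Set (EuclideanSpace ℝ (Fin m))) (D : Set (EuclideanSpace ℝ (Fin p)))
    (h : EuclideanSpace ℝ (Fin n) → ℝ) (γ : ℝ) (x : EuclideanSpace ℝ (Fin n)) : ℝ :=
  ⨆ ξ : BackwardStrategy U D, ⨅ u : BackwardSignal U,
    ⨆ t : Iic (0 : ℝ), Real.exp (γ * t) * h (backwardTrajectory f u.1 (ξ.1 u).1 x t)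

/-- The Bellman backup operator `B_T`. -/
noncomputable def bellmanBackup {n m p : ℕ}
    (f : EuclideanSpace ℝ (Fin n) → EuclideanSpace ℝ (Fin m) → EuclideanSpace ℝ (Fin p) →
      EuclideanSpace ℝ (Fin n))
    (U : Set (EuclideanSpace ℝ (Fin m))) (D : Set (EuclideanSpace ℝ (Fin p)))
    (h : EuclideanSpace ℝ (Fin n) → ℝ) (γ T : ℝ) (V : EuclideanSpace ℝ (Fin n) → ℝ)
    (x : EuclideanSpace ℝ (Fin n)) : ℝ :=
  ⨆ ξ : BackwardStrategy U D, ⨅ u : BackwardSignal U,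
    max (⨆ t : Icc (-T) (0 : ℝ), Real.exp (γ * t) * h (backwardTrajectory f u.1 (ξ.1 u).1 x t))
      (Real.exp (-(γ * T)) * V (backwardTrajectory f u.1 (ξ.1 u).1 x (-T)))

/-- Bounded and uniformly continuous real functions on `ℝⁿ`. -/
def IsBUC {n : ℕ} (V : EuclideanSpace ℝ (Fin n) → ℝ) : Prop :=
  (∃ C : ℝ, ∀ x, |V x| ≤ C) ∧ UniformContinuous V

/-- The sup norm (used for bounded functions only). -/
noncomputable def supNorm {n : ℕ} (V : EuclideanSpace ℝ (Fin n) → ℝ) : ℝ :=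
  ⨆ x, |V x|

end FRT

/-! For fixed signals, two terminal payoffs `V` and `W` change only the second entry of the maximum
in `backupCost`, by at most `e^{-γT}‖V - W‖`. Since `max` and sup-inf are nonexpansive, `B_T` is an
`e^{-γT}`-contraction on bounded functions (`abs_bellmanBackup_sub_le`). The value function is a
fixed point of `B_T`: this is the dynamic programming principle `bellmanBackup_valueFunction`. The
two facts give the error estimate and convergence.

The dynamic programming principle rests on a pathwise splitting of the payoff at time `-T`
(`tailCost_eq_max`) and on two operations on strategies, `BackwardStrategy.after` and
`BackwardStrategy.switch`. Both use that trajectories are unique and depend on signals only up to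
null sets.

On a finite horizon, trajectories are Lipschitz in the terminal state uniformly in the signals, so
`B_T` preserves BUC (`isBUC_bellmanBackup`). That Lipschitz constant grows with `T`, so uniform
continuity of the value function is obtained differently: it is the uniform limit of the iterates.
-/

namespace FRT

/-! ### Backward trajectories: existence, uniqueness, dependence on the data. -/

section Dynamics

variable {n m p : ℕ}
  {f : EuclideanSpace ℝ (Fin n) → EuclideanSpace ℝ (Fin m) → EuclideanSpace ℝ (Fin p) →
    EuclideanSpace ℝ (Fin n)}
  {U : Set (EuclideanSpace ℝ (Fin m))} {D : Set (EuclideanSpace ℝ (Fin p))}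

theorem aestronglyMeasurable_field (hU : IsCompact U) (hD : IsCompact D)
    (hf : DynamicsAssumption f U D) {u : ℝ → EuclideanSpace ℝ (Fin m)}
    {d : ℝ → EuclideanSpace ℝ (Fin p)} (hu : u ∈ BackwardSignal U) (hd : d ∈ BackwardSignal D)
    {x : ℝ → EuclideanSpace ℝ (Fin n)} (hx : ContinuousOn x (Iic 0)) :
    AEStronglyMeasurable (fun s => f (x s) (u s) (d s)) (volume.restrict (Iic 0)) := by
  classical
  set S : Set (EuclideanSpace ℝ (Fin n) × EuclideanSpace ℝ (Fin m) × EuclideanSpace ℝ (Fin p)) :=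
    univ ×ˢ U ×ˢ D with hS
  have hSm : MeasurableSet S :=
    MeasurableSet.univ.prod (hU.isClosed.measurableSet.prod hD.isClosed.measurableSet)
  -- Nothing is known about `f` off `S`, so it is replaced by its extension by zero, which is Borel
  -- and agrees with `f` along the signals at times `t ≤ 0`.
  have hg : Measurable (S.piecewise
      (fun q : EuclideanSpace ℝ (Fin n) × EuclideanSpace ℝ (Fin m) × EuclideanSpace ℝ (Fin p) =>
        f q.1 q.2.1 q.2.2) (fun _ => 0)) :=
    hf.uniformContinuous.continuousOn.measurable_piecewise continuousOn_const hSm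
  have hq : AEMeasurable (fun s => (x s, u s, d s)) (volume.restrict (Iic 0)) :=
    (hx.aemeasurable measurableSet_Iic).prodMk (hu.1.prodMk hd.1)
  refine AEMeasurable.aestronglyMeasurable ((hg.comp_aemeasurable hq).congr ?_)
  filter_upwards [ae_restrict_mem measurableSet_Iic] with s hs
  have : (x s, u s, d s) ∈ S := ⟨mem_univ _, hu.2 s hs, hd.2 s hs⟩
  simp [Function.comp, this]

theorem uIoc_subset_Iic_zero {a b : ℝ} (ha : a ≤ 0) (hb : b ≤ 0) : uIoc a b ⊆ Iic 0 :=
  fun _ hs => hs.2.trans (max_le ha hb)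

theorem intervalIntegrable_field (hU : IsCompact U) (hD : IsCompact D)
    (hf : DynamicsAssumption f U D) {u : ℝ → EuclideanSpace ℝ (Fin m)}
    {d : ℝ → EuclideanSpace ℝ (Fin p)} (hu : u ∈ BackwardSignal U) (hd : d ∈ BackwardSignal D)
    {x : ℝ → EuclideanSpace ℝ (Fin n)} (hx : ContinuousOn x (Iic 0))
    {a b : ℝ} (ha : a ≤ 0) (hb : b ≤ 0) :
    IntervalIntegrable (fun s => f (x s) (u s) (d s)) volume a b := by
  obtain ⟨M, -, hM⟩ := hf.bounded
  refine (intervalIntegrable_const (c := M)).mono_fun'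
    ((aestronglyMeasurable_field hU hD hf hu hd hx).mono_set (uIoc_subset_Iic_zero ha hb)) ?_
  filter_upwards [ae_restrict_mem measurableSet_uIoc] with s hs
  have hs0 := uIoc_subset_Iic_zero ha hb hs
  exact hM _ _ (hu.2 s hs0) _ (hd.2 s hs0)

theorem integral_exp_neg_mul {c : ℝ} (hc : 0 < c) (a : ℝ) :
    ∫ s in a..0, Real.exp (-(c * s)) = (Real.exp (-(c * a)) - 1) / c := by
  have h : ∀ s ∈ uIcc a 0, HasDerivAt (fun s => -(Real.exp (-(c * s)) / c))
      (Real.exp (-(c * s))) s := by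
    intro s _
    have h1 : HasDerivAt (fun s : ℝ => -(c * s)) (-(c * 1)) s :=
      ((hasDerivAt_id s).const_mul c).neg
    refine (h1.exp.div_const c).neg.congr_deriv ?_
    field_simp
  rw [intervalIntegral.integral_eq_sub_of_hasDerivAt h
    (Continuous.intervalIntegrable (by fun_prop) _ _)]
  simp
  field_simp
  ring

/-- If the difference of two integrands is at most `L B e^{-(L+1)s}`, then the difference of the
integrals is at most `L / (L+1) * B e^{-(L+1)a}`. -/
theorem norm_integral_sub_le_weighted {E : Type*} [NormedAddCommGroup E] [NormedSpace ℝ E]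
    {F G : ℝ → E} {L B a : ℝ} (hL : 0 ≤ L) (hB : 0 ≤ B) (ha : a ≤ 0)
    (hF : IntervalIntegrable F volume 0 a) (hG : IntervalIntegrable G volume 0 a)
    (h : ∀ᵐ s, s ∈ Ioc a 0 → ‖F s - G s‖ ≤ L * B * Real.exp (-((L + 1) * s))) :
    ‖(∫ s in (0 : ℝ)..a, F s) - ∫ s in (0 : ℝ)..a, G s‖ ≤
      L / (L + 1) * B * Real.exp (-((L + 1) * a)) := by
  rw [← intervalIntegral.integral_sub hF hG, intervalIntegral.integral_symm, norm_neg]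
  have h1 := intervalIntegral.norm_integral_le_of_norm_le ha h
    (Continuous.intervalIntegrable (by fun_prop) _ _)
  rw [intervalIntegral.integral_const_mul, integral_exp_neg_mul (by positivity)] at h1
  refine h1.trans ?_
  have : L * B * ((Real.exp (-((L + 1) * a)) - 1) / (L + 1)) =
      L / (L + 1) * B * (Real.exp (-((L + 1) * a)) - 1) := by field_simp
  rw [this]
  exact mul_le_mul_of_nonneg_left (by linarith) (by positivity)

/-- Picard iteration in a weighted sup norm. Writing `x s = x₀ + e^{-(L+1)s} y s` with `y` bounded
makes the Picard map a contraction with factor `L/(L+1)` on the whole half-line, so no local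
solutions have to be glued. -/
theorem exists_isBackwardTrajectory (hU : IsCompact U) (hD : IsCompact D)
    (hf : DynamicsAssumption f U D) {u : ℝ → EuclideanSpace ℝ (Fin m)}
    {d : ℝ → EuclideanSpace ℝ (Fin p)} (hu : u ∈ BackwardSignal U) (hd : d ∈ BackwardSignal D)
    (x₀ : EuclideanSpace ℝ (Fin n)) : ∃ x, IsBackwardTrajectory f u d x₀ x := by
  obtain ⟨M, hM0, hM⟩ := hf.bounded
  obtain ⟨L, hL⟩ := hf.lipschitz
  have hL0 : (0 : ℝ) ≤ L := L.2
  let X : BoundedContinuousFunction ℝ (EuclideanSpace ℝ (Fin n)) → ℝ → EuclideanSpace ℝ (Fin n) :=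
    fun y s => x₀ + Real.exp (-((L + 1) * s)) • y s
  have hX : ∀ y, Continuous (X y) := fun y => by
    have := y.continuous
    fun_prop
  have hint : ∀ y {a b : ℝ}, a ≤ 0 → b ≤ 0 →
      IntervalIntegrable (fun s => f (X y s) (u s) (d s)) volume a b := fun y _ _ ha hb =>
    intervalIntegrable_field hU hD hf hu hd (hX y).continuousOn ha hb
  have hbd : ∀ y {a b : ℝ}, a ≤ 0 → b ≤ 0 →
      ‖∫ s in a..b, f (X y s) (u s) (d s)‖ ≤ M * |b - a| := fun y _ _ ha hb =>
    intervalIntegral.norm_integral_le_of_norm_le_const fun s hs =>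
      hM _ _ (hu.2 s (uIoc_subset_Iic_zero ha hb hs)) _ (hd.2 s (uIoc_subset_Iic_zero ha hb hs))
  have hprim : ∀ y, ContinuousOn (fun t => ∫ s in (0 : ℝ)..t, f (X y s) (u s) (d s)) (Iic 0) := by
    intro y
    refine LipschitzOnWith.continuousOn (K := ⟨M, hM0.le⟩) (LipschitzOnWith.of_dist_le_mul ?_)
    intro a ha b hb
    rw [dist_eq_norm, intervalIntegral.integral_interval_sub_left (hint y le_rfl ha)
      (hint y le_rfl hb)]
    exact hbd y hb ha
  -- The Picard map in terms of `y`. Clamping time at `min t 0` gives a function on all of `ℝ`,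
  -- equal to zero for `t ≥ 0`.
  let Φ : BoundedContinuousFunction ℝ (EuclideanSpace ℝ (Fin n)) →
      BoundedContinuousFunction ℝ (EuclideanSpace ℝ (Fin n)) := fun y =>
    BoundedContinuousFunction.ofNormedAddCommGroup
      (fun t => Real.exp ((L + 1) * min t 0) •
        ∫ s in (0 : ℝ)..min t 0, f (X y s) (u s) (d s))
      (Continuous.smul (f := fun t : ℝ => Real.exp ((L + 1) * min t 0)) (by fun_prop)
        ((hprim y).comp_continuous (f := fun t : ℝ => min t 0) (by fun_prop)
          fun t => min_le_right t 0)) M (by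
        intro t
        set a := min t 0 with ha
        have ha0 : a ≤ 0 := min_le_right t 0
        rw [norm_smul, Real.norm_eq_abs, Real.abs_exp]
        have h1 := hbd y le_rfl ha0
        rw [sub_zero, abs_of_nonpos ha0] at h1
        have h2 : -a ≤ Real.exp (-((L + 1) * a)) := by
          have := Real.add_one_le_exp (-((L + 1) * a))
          nlinarith
        calc _ ≤ Real.exp ((L + 1) * a) * (M * Real.exp (-((L + 1) * a))) := by gcongr; nlinarith
          _ = M := by
            rw [mul_left_comm, ← Real.exp_add]; simp)
  have hΦt : ∀ y t, Φ y t = Real.exp ((L + 1) * min t 0) •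
      ∫ s in (0 : ℝ)..min t 0, f (X y s) (u s) (d s) := fun _ _ => rfl
  have hK : (L : ℝ≥0) / (L + 1) < 1 := (div_lt_one (by positivity)).2 (by simp)
  have hΦ : ContractingWith (L / (L + 1)) Φ := by
    refine ⟨hK, LipschitzWith.of_dist_le_mul fun y z => ?_⟩
    rw [BoundedContinuousFunction.dist_le (by positivity)]
    intro t
    set a := min t 0 with ha
    have ha0 : a ≤ 0 := min_le_right t 0
    have key := norm_integral_sub_le_weighted (B := dist y z) hL0 dist_nonneg ha0
      (hint y le_rfl ha0) (hint z le_rfl ha0) (ae_of_all _ fun s hs => by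
        refine ((hL _ (hu.2 s hs.2) _ (hd.2 s hs.2)).norm_sub_le _ _).trans ?_
        have : X y s - X z s = Real.exp (-((L + 1) * s)) • (y s - z s) := by
          simp [X, smul_sub]
        rw [this, norm_smul, Real.norm_eq_abs, Real.abs_exp, ← dist_eq_norm, mul_assoc]
        refine mul_le_mul_of_nonneg_left ?_ hL0
        rw [mul_comm]
        exact mul_le_mul_of_nonneg_right (BoundedContinuousFunction.dist_coe_le_dist s)
          (Real.exp_pos _).le)
    rw [hΦt, hΦt, dist_eq_norm, ← smul_sub, norm_smul, Real.norm_eq_abs, Real.abs_exp]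
    calc _ ≤ Real.exp ((L + 1) * a) *
          ((L : ℝ) / (L + 1) * dist y z * Real.exp (-((L + 1) * a))) := by gcongr
      _ = (L : ℝ) / (L + 1) * dist y z := by
        rw [mul_left_comm, ← Real.exp_add]; simp
      _ = _ := by push_cast; rfl
  set y := hΦ.fixedPoint Φ
  have hy : Φ y = y := hΦ.fixedPoint_isFixedPt
  refine ⟨X y, (hX y).continuousOn, fun t ht => ⟨hint y le_rfl ht, ?_⟩⟩
  have h1 := hΦt y t
  rw [hy, min_eq_left ht] at h1
  change x₀ + Real.exp (-((L + 1) * t)) • y t = _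
  rw [h1, smul_smul, ← Real.exp_add]
  simp

/-- Trajectories depend continuously on the terminal state, and only on the signals up to null
sets on the elapsed time interval. -/
theorem IsBackwardTrajectory.norm_sub_le {L : ℝ≥0}
    (hL : ∀ u ∈ U, ∀ d ∈ D, LipschitzWith L (fun x => f x u d))
    {u u' : ℝ → EuclideanSpace ℝ (Fin m)} {d d' : ℝ → EuclideanSpace ℝ (Fin p)}
    (hu : u ∈ BackwardSignal U) (hd : d ∈ BackwardSignal D)
    {x₀ y₀ : EuclideanSpace ℝ (Fin n)} {x y : ℝ → EuclideanSpace ℝ (Fin n)}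
    (hx : IsBackwardTrajectory f u d x₀ x) (hy : IsBackwardTrajectory f u' d' y₀ y) {s : ℝ}
    (huu : ∀ᵐ τ ∂(volume.restrict (Icc s 0)), u τ = u' τ)
    (hdd : ∀ᵐ τ ∂(volume.restrict (Icc s 0)), d τ = d' τ) {t : ℝ} (ht : t ∈ Icc s 0) :
    ‖x t - y t‖ ≤ (L + 1) * ‖x₀ - y₀‖ * Real.exp (-((L + 1) * t)) := by
  have hL0 : (0 : ℝ) ≤ L := L.2
  have hc : ContinuousOn (fun τ => Real.exp ((L + 1) * τ) * ‖x τ - y τ‖) (Icc s 0) :=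
    ContinuousOn.mul (by fun_prop)
      (((hx.1.mono Icc_subset_Iic_self).sub (hy.1.mono Icc_subset_Iic_self)).norm)
  -- In place of Gronwall: the integral equation at a maximum point of the weighted difference
  -- yields `B ≤ ‖x₀ - y₀‖ + L/(L+1) * B`, and the last term is absorbed.
  obtain ⟨r, hr, hmax⟩ := isCompact_Icc.exists_isMaxOn ⟨t, ht⟩ hc
  set B := Real.exp ((L + 1) * r) * ‖x r - y r‖ with hB
  have hB0 : 0 ≤ B := by positivity
  have hle : ∀ τ ∈ Icc s 0, ‖x τ - y τ‖ ≤ B * Real.exp (-((L + 1) * τ)) := by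
    intro τ hτ
    have h1 : Real.exp ((L + 1) * τ) * ‖x τ - y τ‖ ≤ B := hmax hτ
    calc ‖x τ - y τ‖ = Real.exp ((L + 1) * τ) * ‖x τ - y τ‖ * Real.exp (-((L + 1) * τ)) := by
          rw [mul_right_comm, ← Real.exp_add]; simp
      _ ≤ _ := by gcongr
  have key := norm_integral_sub_le_weighted (B := B) hL0 hB0 hr.2
    (hx.2 r hr.2).1 (hy.2 r hr.2).1 (by
      rw [ae_restrict_iff' measurableSet_Icc] at huu hdd
      filter_upwards [huu, hdd] with τ h1 h2 hτ
      have hτ' : τ ∈ Icc s 0 := ⟨hr.1.trans hτ.1.le, hτ.2⟩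
      rw [← h1 hτ', ← h2 hτ', mul_assoc]
      refine ((hL _ (hu.2 τ hτ.2) _ (hd.2 τ hτ.2)).norm_sub_le _ _).trans ?_
      gcongr
      exact hle τ hτ')
  have h3 : ‖x r - y r‖ ≤ ‖x₀ - y₀‖ + L / (L + 1) * B * Real.exp (-((L + 1) * r)) := by
    rw [(hx.2 r hr.2).2, (hy.2 r hr.2).2, add_sub_add_comm]
    exact (norm_add_le _ _).trans (by gcongr)
  have h4 : B ≤ ‖x₀ - y₀‖ + L / (L + 1) * B := by
    have he : Real.exp ((L + 1) * r) ≤ 1 := Real.exp_le_one_iff.2 (by nlinarith [hr.2])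
    calc B ≤ Real.exp ((L + 1) * r) *
          (‖x₀ - y₀‖ + L / (L + 1) * B * Real.exp (-((L + 1) * r))) := by
          rw [hB]; gcongr
      _ = Real.exp ((L + 1) * r) * ‖x₀ - y₀‖ + L / (L + 1) * B *
          (Real.exp ((L + 1) * r) * Real.exp (-((L + 1) * r))) := by ring
      _ ≤ _ := by
        rw [← Real.exp_add, add_neg_cancel, Real.exp_zero, mul_one]
        gcongr
        exact mul_le_of_le_one_left (norm_nonneg _) he
  have h5 : B ≤ (L + 1) * ‖x₀ - y₀‖ := by
    have hp : (0 : ℝ) < L + 1 := by positivity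
    have h6 : B - L / (L + 1) * B = B / (L + 1) := by field_simp; ring
    have h7 : B / (L + 1) ≤ ‖x₀ - y₀‖ := by linarith
    rw [div_le_iff₀ hp] at h7
    linarith
  refine (hle t ht).trans ?_
  gcongr

theorem isBackwardTrajectory_backwardTrajectory (hU : IsCompact U) (hD : IsCompact D)
    (hf : DynamicsAssumption f U D) (u : BackwardSignal U) (d : BackwardSignal D)
    (x₀ : EuclideanSpace ℝ (Fin n)) :
    IsBackwardTrajectory f u.1 d.1 x₀ (backwardTrajectory f u.1 d.1 x₀) :=
  Classical.epsilon_spec (exists_isBackwardTrajectory hU hD hf u.2 d.2 x₀)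

theorem IsBackwardTrajectory.eqOn (hf : DynamicsAssumption f U D)
    {u u' : BackwardSignal U} {d d' : BackwardSignal D}
    {x₀ : EuclideanSpace ℝ (Fin n)} {x y : ℝ → EuclideanSpace ℝ (Fin n)}
    (hx : IsBackwardTrajectory f u.1 d.1 x₀ x) (hy : IsBackwardTrajectory f u'.1 d'.1 x₀ y) {s : ℝ}
    (huu : ∀ᵐ τ ∂(volume.restrict (Icc s 0)), u.1 τ = u'.1 τ)
    (hdd : ∀ᵐ τ ∂(volume.restrict (Icc s 0)), d.1 τ = d'.1 τ) : EqOn x y (Icc s 0) := by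
  obtain ⟨L, hL⟩ := hf.lipschitz
  intro t ht
  have := hx.norm_sub_le hL u.2 d.2 hy huu hdd ht
  rw [sub_self, norm_zero, mul_zero, zero_mul] at this
  exact sub_eq_zero.1 (norm_le_zero_iff.1 this)

end Dynamics

/-! ### Shifting and concatenating signals. -/

section Signals

variable {m : ℕ} {A : Set (EuclideanSpace ℝ (Fin m))}

/-- The signal `t ↦ u (t - T)` on `(-∞, 0]`. -/
def BackwardSignal.shift {T : ℝ} (hT : 0 ≤ T) (u : BackwardSignal A) : BackwardSignal A :=
  ⟨fun t => u.1 (t - T), by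
    refine ⟨?_, fun t ht => u.2.2 _ (by linarith)⟩
    have h := (measurePreserving_sub_right (volume : Measure ℝ) T).restrict_preimage
      (measurableSet_Iic (a := -T))
    have hpre : (fun t => t - T) ⁻¹' Iic (-T) = Iic 0 := by ext t; simp
    rw [hpre] at h
    exact (u.2.1.mono_set (Iic_subset_Iic.2 (by linarith))).comp_quasiMeasurePreserving
      h.quasiMeasurePreserving⟩

/-- The signal equal to `u` on `(-T, 0]` and to `t ↦ v (t + T)` on `(-∞, -T]`. -/
noncomputable def BackwardSignal.concat {T : ℝ} (hT : 0 ≤ T) (u v : BackwardSignal A) :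
    BackwardSignal A :=
  ⟨fun t => if -T < t then u.1 t else v.1 (t + T), by
    refine ⟨?_, fun t ht => ?_⟩
    · rw [← Iic_union_Ioc_eq_Iic (show -T ≤ 0 by linarith), aemeasurable_union_iff]
      constructor
      · have h := (measurePreserving_add_right (volume : Measure ℝ) T).restrict_preimage
          (measurableSet_Iic (a := 0))
        have hpre : (fun t => t + T) ⁻¹' Iic 0 = Iic (-T) := by
          ext t; simp only [mem_preimage, mem_Iic]; constructor <;> intro _ <;> linarith
        rw [hpre] at h
        refine (v.2.1.comp_quasiMeasurePreserving h.quasiMeasurePreserving).congr ?_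
        filter_upwards [ae_restrict_mem measurableSet_Iic] with t ht
        simp [not_lt.2 (mem_Iic.1 ht)]
      · refine (u.2.1.mono_set Ioc_subset_Iic_self).congr ?_
        filter_upwards [ae_restrict_mem measurableSet_Ioc] with t ht
        simp [ht.1]
    · dsimp only
      split_ifs with h
      · exact u.2.2 t ht
      · exact v.2.2 _ (by linarith)⟩

/-- Almost everywhere equality of two signals on `[s, 0]`. -/
def BackwardSignal.EqFrom (s : ℝ) (u v : BackwardSignal A) : Prop :=
  ∀ᵐ τ ∂(volume.restrict (Icc s 0)), u.1 τ = v.1 τ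

namespace BackwardSignal

variable {T s r : ℝ} {u v : BackwardSignal A}

theorem eqFrom_iff : EqFrom s u v ↔ ∀ᵐ τ, τ ∈ Icc s 0 → u.1 τ = v.1 τ :=
  ae_restrict_iff' measurableSet_Icc

theorem EqFrom.refl (s : ℝ) (u : BackwardSignal A) : EqFrom s u u := ae_of_all _ fun _ => rfl

theorem EqFrom.mono (h : EqFrom s u v) (hr : s ≤ r) : EqFrom r u v := by
  rw [eqFrom_iff] at h ⊢
  filter_upwards [h] with τ h1 h2 using h1 ⟨hr.trans h2.1, h2.2⟩

theorem ae_sub_right {P : ℝ → Prop} (h : ∀ᵐ τ, P τ) (T : ℝ) : ∀ᵐ τ, P (τ - T) :=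
  (measurePreserving_sub_right (volume : Measure ℝ) T).quasiMeasurePreserving.ae h

theorem EqFrom.shift (hT : 0 ≤ T) (h : EqFrom (s - T) u v) :
    EqFrom s (shift hT u) (shift hT v) := by
  rw [eqFrom_iff] at h ⊢
  filter_upwards [ae_sub_right h T] with τ h1 h2
  exact h1 ⟨by linarith [h2.1], by linarith [h2.2]⟩

theorem concat_eqFrom_left (hT : 0 ≤ T) (u v : BackwardSignal A) :
    EqFrom (-T) (concat hT u v) u := by
  rw [eqFrom_iff]
  -- At `-T` itself the concatenation already takes its value from `v`; this single point is null.
  filter_upwards [volume.ae_ne (-T)] with τ h1 h2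
  have : -T < τ := lt_of_le_of_ne h2.1 h1.symm
  simp [concat, this]

/-- Only equality on each `[s, 0]`, not equality of signals: the values at positive times come from
`u`. This is why payoffs are compared through `EqFrom`. -/
theorem shift_concat_eqFrom (hT : 0 ≤ T) (u v : BackwardSignal A) (s : ℝ) :
    EqFrom s (shift hT (concat hT u v)) v := by
  rw [eqFrom_iff]
  refine ae_of_all _ fun τ hτ => ?_
  have : ¬ -T < τ - T := by linarith [hτ.2]
  simp only [shift, concat]
  rw [if_neg this, sub_add_cancel]

/-- The second signals matter only when the window reaches back to `-T`. The implication in `hv` is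
what `BackwardStrategy.switch` needs, since only then do the controls agree on all of `[-T, 0]` and
lead to the same state at `-T`. -/
theorem EqFrom.concat (hT : 0 ≤ T) {u' v' : BackwardSignal A}
    (hu : EqFrom (max s (-T)) u u') (hv : s ≤ -T → EqFrom (s + T) v v') :
    EqFrom s (concat hT u v) (concat hT u' v') := by
  rw [eqFrom_iff] at hu ⊢
  have hv' : ∀ᵐ τ, τ ∈ Icc s (-T) → v.1 (τ + T) = v'.1 (τ + T) := by
    by_cases hs : s ≤ -T
    · have := ae_sub_right (eqFrom_iff.1 (hv hs)) (-T)
      filter_upwards [this] with τ h1 h2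
      rw [sub_neg_eq_add] at h1
      exact h1 ⟨by linarith [h2.1], by linarith [h2.2]⟩
    · exact ae_of_all _ fun τ hτ => absurd (hτ.1.trans hτ.2) hs
  filter_upwards [hu, hv'] with τ h1 h2 hτ
  simp only [BackwardSignal.concat]
  split_ifs with h
  · exact h1 ⟨max_le hτ.1 h.le, hτ.2⟩
  · exact h2 ⟨hτ.1, not_lt.1 h⟩

theorem nonempty (hA : A.Nonempty) : Nonempty (BackwardSignal A) :=
  hA.elim fun a ha => ⟨⟨fun _ => a, aemeasurable_const, fun _ _ => ha⟩⟩

end BackwardSignal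

theorem BackwardStrategy.nonempty {p : ℕ} {D : Set (EuclideanSpace ℝ (Fin p))}
    (hD : D.Nonempty) : Nonempty (BackwardStrategy A D) :=
  (BackwardSignal.nonempty hD).elim fun d => ⟨⟨fun _ => d, fun _ _ _ _ _ =>
    ae_of_all _ fun _ => rfl⟩⟩

end Signals

/-! ### Nonexpansiveness of sup-inf for bounded payoffs. -/

section MaxMin

/-- The uniform bounds keep every supremum and infimum away from the default value that `ℝ` assigns
to unbounded families. -/
theorem iSup_iInf_le_add {A B : Type*} [Nonempty A] [Nonempty B] {F G : A → B → ℝ} {C C' ε : ℝ}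
    (hF : ∀ a b, |F a b| ≤ C) (hG : ∀ a b, |G a b| ≤ C') (h : ∀ a b, F a b ≤ G a b + ε) :
    (⨆ a, ⨅ b, F a b) ≤ (⨆ a, ⨅ b, G a b) + ε := by
  have hFb : ∀ a, BddBelow (range (F a)) := fun a =>
    ⟨-C, forall_mem_range.2 fun b => (abs_le.1 (hF a b)).1⟩
  have hGb : ∀ a, BddBelow (range (G a)) := fun a =>
    ⟨-C', forall_mem_range.2 fun b => (abs_le.1 (hG a b)).1⟩
  have hGa : BddAbove (range fun a => ⨅ b, G a b) :=
    ⟨C', forall_mem_range.2 fun a => (ciInf_le (hGb a) (Classical.arbitrary B)).trans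
      (abs_le.1 (hG a _)).2⟩
  refine ciSup_le fun a => ?_
  have h1 : (⨅ b, F a b) - ε ≤ ⨅ b, G a b :=
    le_ciInf fun b => by linarith [ciInf_le (hFb a) b, h a b]
  linarith [le_ciSup hGa a]

theorem abs_iSup_iInf_sub_le {A B : Type*} [Nonempty A] [Nonempty B] {F G : A → B → ℝ}
    {C C' ε : ℝ} (hF : ∀ a b, |F a b| ≤ C) (hG : ∀ a b, |G a b| ≤ C')
    (h : ∀ a b, |F a b - G a b| ≤ ε) :
    |(⨆ a, ⨅ b, F a b) - ⨆ a, ⨅ b, G a b| ≤ ε := by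
  rw [abs_le]
  constructor
  · linarith [iSup_iInf_le_add (ε := ε) hG hF fun a b => by linarith [(abs_le.1 (h a b)).1]]
  · linarith [iSup_iInf_le_add (ε := ε) hF hG fun a b => by linarith [(abs_le.1 (h a b)).2]]

theorem abs_iSup_iInf_le {A B : Type*} [Nonempty A] [Nonempty B] {F : A → B → ℝ} {C : ℝ}
    (hF : ∀ a b, |F a b| ≤ C) : |⨆ a, ⨅ b, F a b| ≤ C := by
  have hC : 0 ≤ C := (abs_nonneg _).trans (hF (Classical.arbitrary A) (Classical.arbitrary B))
  simpa using abs_iSup_iInf_sub_le (G := fun _ _ => 0) (C' := C) hF (fun _ _ => by simpa using hC)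
    (ε := C) (by simpa using hF)

theorem exists_iInf_lt_add {B : Type*} [Nonempty B] {F : B → ℝ} {c ε : ℝ} (hε : 0 < ε)
    (h : ⨅ b, F b ≤ c) : ∃ b, F b < c + ε :=
  exists_lt_of_ciInf_lt (by linarith)

theorem iInf_le_iSup_iInf {A B : Type*} [Nonempty B] {F : A → B → ℝ} {C : ℝ}
    (hF : ∀ a b, |F a b| ≤ C) (a : A) : (⨅ b, F a b) ≤ ⨆ a, ⨅ b, F a b :=
  le_ciSup (f := fun a => ⨅ b, F a b) ⟨C, forall_mem_range.2 fun a =>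
    (ciInf_le ⟨-C, forall_mem_range.2 fun b => (abs_le.1 (hF a b)).1⟩
      (Classical.arbitrary B)).trans (abs_le.1 (hF a _)).2⟩ a

theorem abs_iSup_sub_iSup_le {A : Type*} [Nonempty A] {F G : A → ℝ} {C C' ε : ℝ}
    (hF : ∀ a, |F a| ≤ C) (hG : ∀ a, |G a| ≤ C') (h : ∀ a, |F a - G a| ≤ ε) :
    |(⨆ a, F a) - ⨆ a, G a| ≤ ε := by
  -- A supremum is a sup-inf whose inner player has a single move.
  simpa using abs_iSup_iInf_sub_le (F := fun a (_ : Unit) => F a) (G := fun a _ => G a)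
    (fun a _ => hF a) (fun a _ => hG a) (fun a _ => h a)

theorem abs_iSup_le {A : Type*} [Nonempty A] {F : A → ℝ} {C : ℝ} (hF : ∀ a, |F a| ≤ C) :
    |⨆ a, F a| ≤ C := by
  simpa using abs_iSup_iInf_le (F := fun a (_ : Unit) => F a) (fun a _ => hF a)

theorem bddAbove_range_of_abs_le {A : Type*} {F : A → ℝ} {C : ℝ} (hF : ∀ a, |F a| ≤ C) :
    BddAbove (range F) :=
  ⟨C, forall_mem_range.2 fun a => (le_abs_self _).trans (hF a)⟩

end MaxMin

/-! ### Payoffs and the dynamic programming principle. -/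

section Game

open BackwardSignal

variable {n m p : ℕ}
  {f : EuclideanSpace ℝ (Fin n) → EuclideanSpace ℝ (Fin m) → EuclideanSpace ℝ (Fin p) →
    EuclideanSpace ℝ (Fin n)}
  {U : Set (EuclideanSpace ℝ (Fin m))} {D : Set (EuclideanSpace ℝ (Fin p))}

theorem backwardTrajectory_congr (hU : IsCompact U) (hD : IsCompact D)
    (hf : DynamicsAssumption f U D) {u u' : BackwardSignal U} {d d' : BackwardSignal D}
    (x : EuclideanSpace ℝ (Fin n)) {s t : ℝ} (hu : EqFrom s u u') (hd : EqFrom s d d')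
    (ht : t ∈ Icc s 0) :
    backwardTrajectory f u.1 d.1 x t = backwardTrajectory f u'.1 d'.1 x t :=
  (isBackwardTrajectory_backwardTrajectory hU hD hf u d x).eqOn hf
    (isBackwardTrajectory_backwardTrajectory hU hD hf u' d' x) hu hd ht

/-- Flow property: `f` has no explicit time dependence, so a translated trajectory solves the
equation with translated signals, and uniqueness applies. -/
theorem backwardTrajectory_shift (hU : IsCompact U) (hD : IsCompact D)
    (hf : DynamicsAssumption f U D) (u : BackwardSignal U) (d : BackwardSignal D)
    (x : EuclideanSpace ℝ (Fin n)) {T : ℝ} (hT : 0 ≤ T) {t : ℝ} (ht : t ≤ 0) :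
    backwardTrajectory f (shift hT u).1 (shift hT d).1 (backwardTrajectory f u.1 d.1 x (-T)) t =
      backwardTrajectory f u.1 d.1 x (t - T) := by
  have hx := isBackwardTrajectory_backwardTrajectory hU hD hf u d x
  set X := backwardTrajectory f u.1 d.1 x
  have hX : IsBackwardTrajectory f (shift hT u).1 (shift hT d).1 (X (-T)) fun t => X (t - T) := by
    have hc : ContinuousOn (fun t => X (t - T)) (Iic 0) :=
      hx.1.comp (by fun_prop) fun t ht => by
        simp only [mem_Iic] at ht ⊢
        linarith
    refine ⟨hc, fun t ht => ⟨intervalIntegrable_field hU hD hf (shift hT u).2 (shift hT d).2 hc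
      le_rfl ht, ?_⟩⟩
    change X (t - T) = X (-T) + ∫ s in (0 : ℝ)..t, f (X (s - T)) (u.1 (s - T)) (d.1 (s - T))
    rw [intervalIntegral.integral_comp_sub_right (fun s => f (X s) (u.1 s) (d.1 s)) T,
      (hx.2 (t - T) (by linarith)).2, (hx.2 (-T) (by linarith)).2, zero_sub, add_assoc,
      intervalIntegral.integral_add_adjacent_intervals (hx.2 (-T) (by linarith)).1
        (intervalIntegrable_field hU hD hf u.2 d.2 hx.1 (by linarith) (by linarith))]
  exact (isBackwardTrajectory_backwardTrajectory hU hD hf _ _ _).eqOn hf hX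
    (EqFrom.refl t _) (EqFrom.refl t _) ⟨le_rfl, ht⟩

/-- The payoff of a pair of signals over the infinite backward horizon. -/
noncomputable def tailCost (f : EuclideanSpace ℝ (Fin n) → EuclideanSpace ℝ (Fin m) →
      EuclideanSpace ℝ (Fin p) → EuclideanSpace ℝ (Fin n))
    (h : EuclideanSpace ℝ (Fin n) → ℝ) (γ : ℝ) (x : EuclideanSpace ℝ (Fin n))
    (u : BackwardSignal U) (d : BackwardSignal D) : ℝ :=
  ⨆ t : Iic (0 : ℝ), Real.exp (γ * t) * h (backwardTrajectory f u.1 d.1 x t)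

/-- The payoff of a pair of signals over the backward horizon `[-T, 0]`. -/
noncomputable def horizonCost (f : EuclideanSpace ℝ (Fin n) → EuclideanSpace ℝ (Fin m) →
      EuclideanSpace ℝ (Fin p) → EuclideanSpace ℝ (Fin n))
    (h : EuclideanSpace ℝ (Fin n) → ℝ) (γ T : ℝ) (x : EuclideanSpace ℝ (Fin n))
    (u : BackwardSignal U) (d : BackwardSignal D) : ℝ :=
  ⨆ t : Icc (-T) (0 : ℝ), Real.exp (γ * t) * h (backwardTrajectory f u.1 d.1 x t)

/-- The payoff over `[-T, 0]` with the discounted terminal payoff `V`. -/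
noncomputable def backupCost (f : EuclideanSpace ℝ (Fin n) → EuclideanSpace ℝ (Fin m) →
      EuclideanSpace ℝ (Fin p) → EuclideanSpace ℝ (Fin n))
    (h : EuclideanSpace ℝ (Fin n) → ℝ) (γ T : ℝ) (V : EuclideanSpace ℝ (Fin n) → ℝ)
    (x : EuclideanSpace ℝ (Fin n)) (u : BackwardSignal U) (d : BackwardSignal D) : ℝ :=
  max (horizonCost f h γ T x u d)
    (Real.exp (-(γ * T)) * V (backwardTrajectory f u.1 d.1 x (-T)))

theorem valueFunction_eq (h : EuclideanSpace ℝ (Fin n) → ℝ) (γ : ℝ)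
    (x : EuclideanSpace ℝ (Fin n)) : valueFunction f U D h γ x =
      ⨆ ξ : BackwardStrategy U D, ⨅ u : BackwardSignal U, tailCost f h γ x u (ξ.1 u) := rfl

theorem bellmanBackup_eq (h : EuclideanSpace ℝ (Fin n) → ℝ) (γ T : ℝ)
    (V : EuclideanSpace ℝ (Fin n) → ℝ) (x : EuclideanSpace ℝ (Fin n)) :
    bellmanBackup f U D h γ T V x =
      ⨆ ξ : BackwardStrategy U D, ⨅ u : BackwardSignal U, backupCost f h γ T V x u (ξ.1 u) := rfl

variable {h : EuclideanSpace ℝ (Fin n) → ℝ} {γ T C : ℝ}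

theorem exp_mul_le_one (hγ : 0 < γ) {t : ℝ} (ht : t ≤ 0) : Real.exp (γ * t) ≤ 1 :=
  Real.exp_le_one_iff.2 (mul_nonpos_of_nonneg_of_nonpos hγ.le ht)

theorem abs_exp_mul_le (hγ : 0 < γ) {t a c : ℝ} (ht : t ≤ 0) (ha : |a| ≤ c) :
    |Real.exp (γ * t) * a| ≤ c := by
  rw [abs_mul, Real.abs_exp]
  exact (mul_le_of_le_one_left (abs_nonneg a) (exp_mul_le_one hγ ht)).trans ha

theorem abs_tailCost_le (hγ : 0 < γ) (hC : ∀ x, |h x| ≤ C) (x : EuclideanSpace ℝ (Fin n))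
    (u : BackwardSignal U) (d : BackwardSignal D) : |tailCost f h γ x u d| ≤ C :=
  abs_iSup_le fun t => abs_exp_mul_le hγ t.2 (hC _)

theorem abs_horizonCost_le (hγ : 0 < γ) (hT : 0 ≤ T) (hC : ∀ x, |h x| ≤ C)
    (x : EuclideanSpace ℝ (Fin n)) (u : BackwardSignal U) (d : BackwardSignal D) :
    |horizonCost f h γ T x u d| ≤ C :=
  have : Nonempty (Icc (-T) (0 : ℝ)) := ⟨⟨0, by simpa using hT, le_rfl⟩⟩
  abs_iSup_le fun t => abs_exp_mul_le hγ t.2.2 (hC _)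

theorem abs_backupCost_le (hγ : 0 < γ) (hT : 0 ≤ T) (hC : ∀ x, |h x| ≤ C)
    {V : EuclideanSpace ℝ (Fin n) → ℝ} {C' : ℝ} (hC' : ∀ x, |V x| ≤ C')
    (x : EuclideanSpace ℝ (Fin n)) (u : BackwardSignal U) (d : BackwardSignal D) :
    |backupCost f h γ T V x u d| ≤ max C C' := by
  refine abs_max_le_max_abs_abs.trans (max_le_max (abs_horizonCost_le hγ hT hC x u d) ?_)
  rw [← mul_neg]
  exact abs_exp_mul_le hγ (by linarith) (hC' _)

theorem tailCost_congr (hU : IsCompact U) (hD : IsCompact D) (hf : DynamicsAssumption f U D)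
    {u u' : BackwardSignal U} {d d' : BackwardSignal D} (x : EuclideanSpace ℝ (Fin n))
    (hu : ∀ s, EqFrom s u u') (hd : ∀ s, EqFrom s d d') :
    tailCost f h γ x u d = tailCost f h γ x u' d' :=
  iSup_congr fun t => by
    rw [backwardTrajectory_congr hU hD hf x (hu t) (hd t) ⟨le_rfl, t.2⟩]

theorem horizonCost_congr (hU : IsCompact U) (hD : IsCompact D) (hf : DynamicsAssumption f U D)
    {u u' : BackwardSignal U} {d d' : BackwardSignal D} (x : EuclideanSpace ℝ (Fin n))
    (hu : EqFrom (-T) u u') (hd : EqFrom (-T) d d') :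
    horizonCost f h γ T x u d = horizonCost f h γ T x u' d' :=
  iSup_congr fun t => by
    rw [backwardTrajectory_congr hU hD hf x hu hd t.2]

/-- The times `t ≤ 0` are split at `-T`. Since `e^{γ(t-T)} = e^{-γT} e^{γt}`, the part before `-T`
is a discounted payoff of the same kind, started from the state at `-T`. -/
theorem tailCost_eq_max (hU : IsCompact U) (hD : IsCompact D) (hf : DynamicsAssumption f U D)
    (hγ : 0 < γ) (hT : 0 ≤ T) (hC : ∀ x, |h x| ≤ C) (x : EuclideanSpace ℝ (Fin n))
    (u : BackwardSignal U) (d : BackwardSignal D) :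
    tailCost f h γ x u d = max (horizonCost f h γ T x u d)
      (Real.exp (-(γ * T)) * tailCost f h γ (backwardTrajectory f u.1 d.1 x (-T))
        (shift hT u) (shift hT d)) := by
  have : Nonempty (Icc (-T) (0 : ℝ)) := ⟨⟨0, by simpa using hT, le_rfl⟩⟩
  have hb : ∀ (y : EuclideanSpace ℝ (Fin n)) (u : BackwardSignal U) (d : BackwardSignal D),
      BddAbove (range fun t : Iic (0 : ℝ) =>
        Real.exp (γ * t) * h (backwardTrajectory f u.1 d.1 y t)) := fun y u d =>
    bddAbove_range_of_abs_le fun t => abs_exp_mul_le hγ t.2 (hC _)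
  have hstep : ∀ t : ℝ, t ≤ 0 → Real.exp (γ * (t - T)) *
      h (backwardTrajectory f u.1 d.1 x (t - T)) = Real.exp (-(γ * T)) * (Real.exp (γ * t) *
        h (backwardTrajectory f (shift hT u).1 (shift hT d).1
          (backwardTrajectory f u.1 d.1 x (-T)) t)) := by
    intro t ht
    rw [backwardTrajectory_shift hU hD hf u d x hT ht, ← mul_assoc, ← Real.exp_add]
    congr 2
    ring
  apply le_antisymm
  · refine ciSup_le fun t => ?_
    by_cases ht : -T ≤ t
    · exact le_max_of_le_left (le_ciSup (f := fun t : Icc (-T) (0 : ℝ) =>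
        Real.exp (γ * t) * h (backwardTrajectory f u.1 d.1 x t))
        (bddAbove_range_of_abs_le fun t => abs_exp_mul_le hγ t.2.2 (hC _)) ⟨t, ht, t.2⟩)
    · have ht' : (t : ℝ) + T ≤ 0 := by linarith
      have := hstep (t + T) ht'
      rw [add_sub_cancel_right] at this
      rw [this]
      exact le_max_of_le_right (mul_le_mul_of_nonneg_left
        (le_ciSup (hb _ _ _) ⟨(t : ℝ) + T, ht'⟩) (Real.exp_pos _).le)
  · refine max_le (ciSup_le fun t => le_ciSup (hb x u d) ⟨t, t.2.2⟩) ?_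
    unfold tailCost
    rw [Real.mul_iSup_of_nonneg (Real.exp_pos _).le]
    refine ciSup_le fun t => ?_
    rw [← hstep t t.2]
    exact le_ciSup (hb x u d) ⟨t - T, by
      have := t.2
      simp only [mem_Iic] at this ⊢
      linarith⟩

/-- The strategy on `(-∞, -T]`, shifted to `(-∞, 0]`, that `ξ` induces after the control `u` has
been played on `(-T, 0]`. -/
noncomputable def BackwardStrategy.after (hT : 0 ≤ T) (ξ : BackwardStrategy U D)
    (u : BackwardSignal U) : BackwardStrategy U D :=
  ⟨fun v => shift hT (ξ.1 (concat hT u v)), fun s hs v w hvw =>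
    EqFrom.shift hT (ξ.2 (s - T) (by linarith) _ _
      (EqFrom.concat hT (EqFrom.refl _ u) fun _ => by rwa [sub_add_cancel]))⟩

/-- The strategy that plays `ξ` on `(-T, 0]`, and then the strategy attached by `η` to the state
reached at time `-T`. -/
noncomputable def BackwardStrategy.switch (hU : IsCompact U) (hD : IsCompact D)
    (hf : DynamicsAssumption f U D) (hT : 0 ≤ T) (x : EuclideanSpace ℝ (Fin n))
    (ξ : BackwardStrategy U D) (η : EuclideanSpace ℝ (Fin n) → BackwardStrategy U D) :
    BackwardStrategy U D :=
  ⟨fun u => concat hT (ξ.1 u)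
      ((η (backwardTrajectory f u.1 (ξ.1 u).1 x (-T))).1 (shift hT u)), fun s hs u v huv => by
    refine EqFrom.concat hT (ξ.2 _ (max_le hs (by linarith)) u v
      (EqFrom.mono huv (le_max_left _ _))) fun hsT => ?_
    have huT : EqFrom (-T) u v := EqFrom.mono huv hsT
    -- Both controls lead to the same state at `-T`, hence select the same continuation. No
    -- measurability of `η` is needed, as strategies are arbitrary non-anticipative maps.
    rw [backwardTrajectory_congr hU hD hf x huT (ξ.2 (-T) (by linarith) u v huT)
      ⟨le_rfl, by linarith⟩]
    exact (η _).2 (s + T) (by linarith) _ _ (EqFrom.shift hT (by rwa [add_sub_cancel_right]))⟩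

/-- Against a given `ξ`, the control concatenates a near-optimal `u` for the backup with a
near-optimal `v` against `BackwardStrategy.after hT ξ u` from the state reached. Each costs `ε/2`,
and discounting does not enlarge the second error. -/
theorem valueFunction_le_bellmanBackup (hU : IsCompact U) (hU' : U.Nonempty) (hD : IsCompact D)
    (hD' : D.Nonempty) (hf : DynamicsAssumption f U D) (hγ : 0 < γ) (hT : 0 ≤ T)
    (hC : ∀ x, |h x| ≤ C) (x : EuclideanSpace ℝ (Fin n)) :
    valueFunction f U D h γ x ≤ bellmanBackup f U D h γ T (valueFunction f U D h γ) x := by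
  have := BackwardSignal.nonempty hU'
  have := BackwardStrategy.nonempty (A := U) hD'
  have hJ := fun (y : EuclideanSpace ℝ (Fin n)) (ξ : BackwardStrategy U D)
    (u : BackwardSignal U) => abs_tailCost_le (f := f) hγ hC y u (ξ.1 u)
  have hVC : ∀ y, |valueFunction f U D h γ y| ≤ C := fun y => abs_iSup_iInf_le (hJ y)
  rw [valueFunction_eq]
  refine ciSup_le fun ξ => le_of_forall_pos_le_add fun ε hε => ?_
  obtain ⟨u, hu⟩ := exists_iInf_lt_add (half_pos hε) (iInf_le_iSup_iInf
    (F := fun (ξ : BackwardStrategy U D) (u : BackwardSignal U) =>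
      backupCost f h γ T (valueFunction f U D h γ) x u (ξ.1 u))
    (fun ξ u => abs_backupCost_le hγ hT hC hVC x u (ξ.1 u)) ξ)
  rw [← bellmanBackup_eq] at hu
  set y := backwardTrajectory f u.1 (ξ.1 u).1 x (-T) with hy
  obtain ⟨v, hv⟩ := exists_iInf_lt_add (half_pos hε) (iInf_le_iSup_iInf
    (F := fun (ξ : BackwardStrategy U D) (u : BackwardSignal U) => tailCost f h γ y u (ξ.1 u))
    (hJ y) (BackwardStrategy.after hT ξ u))
  rw [← valueFunction_eq] at hv
  have hcu := concat_eqFrom_left hT u v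
  -- By non-anticipativity `ξ` answers the concatenation on `[-T, 0]` as it answers `u`, so the
  -- horizon payoff and the state `y` are unchanged.
  have hcd := ξ.2 (-T) (by linarith) _ _ hcu
  have hE : Real.exp (-(γ * T)) ≤ 1 := by
    rw [← mul_neg]; exact exp_mul_le_one hγ (by linarith)
  refine (ciInf_le ⟨-C, forall_mem_range.2 fun u => (abs_le.1 (hJ x ξ u)).1⟩
    (concat hT u v)).trans ?_
  change tailCost f h γ x (concat hT u v) (ξ.1 (concat hT u v)) ≤ _
  rw [tailCost_eq_max hU hD hf hγ hT hC, horizonCost_congr hU hD hf x hcu hcd,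
    backwardTrajectory_congr hU hD hf x hcu hcd ⟨le_rfl, by linarith⟩, ← hy,
    tailCost_congr (d := shift hT (ξ.1 (concat hT u v))) (u' := v) (d' := (BackwardStrategy.after hT ξ u).1 v) hU hD hf y
      (shift_concat_eqFrom hT u v) fun s => EqFrom.refl s _]
  have h1 := max_lt_iff.1 hu
  refine max_le (by linarith [h1.1]) ?_
  have h2 : Real.exp (-(γ * T)) * tailCost f h γ y v ((BackwardStrategy.after hT ξ u).1 v) ≤
      Real.exp (-(γ * T)) * valueFunction f U D h γ y + ε / 2 := by
    refine (mul_le_mul_of_nonneg_left hv.le (Real.exp_pos _).le).trans ?_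
    rw [mul_add]
    gcongr
    exact mul_le_of_le_one_left (half_pos hε).le hE
  linarith [h1.2]

/-- Given `ξ`, an `ε`-optimal strategy `η y` is chosen for each state `y`. Switching from `ξ` to `η
y` at time `-T` loses at most `ε` against every control. -/
theorem bellmanBackup_le_valueFunction (hU : IsCompact U) (hU' : U.Nonempty) (hD : IsCompact D)
    (hD' : D.Nonempty) (hf : DynamicsAssumption f U D) (hγ : 0 < γ) (hT : 0 ≤ T)
    (hC : ∀ x, |h x| ≤ C) (x : EuclideanSpace ℝ (Fin n)) :
    bellmanBackup f U D h γ T (valueFunction f U D h γ) x ≤ valueFunction f U D h γ x := by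
  have := BackwardSignal.nonempty hU'
  have := BackwardStrategy.nonempty (A := U) hD'
  have hJ := fun (y : EuclideanSpace ℝ (Fin n)) (ξ : BackwardStrategy U D)
    (u : BackwardSignal U) => abs_tailCost_le (f := f) hγ hC y u (ξ.1 u)
  have hVC : ∀ y, |valueFunction f U D h γ y| ≤ C := fun y => abs_iSup_iInf_le (hJ y)
  rw [bellmanBackup_eq]
  refine ciSup_le fun ξ => le_of_forall_pos_le_add fun ε hε => ?_
  have hη : ∀ y, ∃ η : BackwardStrategy U D, valueFunction f U D h γ y - ε <
      ⨅ u : BackwardSignal U, tailCost f h γ y u (η.1 u) := fun y =>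
    exists_lt_of_lt_ciSup (by rw [← valueFunction_eq]; linarith)
  choose η hη using hη
  have hE : Real.exp (-(γ * T)) ≤ 1 := by
    rw [← mul_neg]; exact exp_mul_le_one hγ (by linarith)
  set ζ : BackwardStrategy U D := BackwardStrategy.switch hU hD hf hT x ξ η with hζ
  rw [← sub_le_iff_le_add]
  refine le_trans (le_ciInf fun u => ?_) (iInf_le_iSup_iInf (hJ x) ζ)
  have hcu := EqFrom.refl (-T) u
  have hcd : EqFrom (-T) (ζ.1 u) (ξ.1 u) := concat_eqFrom_left hT _ _
  set y := backwardTrajectory f u.1 (ξ.1 u).1 x (-T) with hy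
  rw [tailCost_eq_max hU hD hf hγ hT hC, horizonCost_congr hU hD hf x hcu hcd,
    backwardTrajectory_congr hU hD hf x hcu hcd ⟨le_rfl, by linarith⟩, ← hy,
    tailCost_congr (d := shift hT (ζ.1 u)) (u' := shift hT u) (d' := (η y).1 (shift hT u)) hU hD hf y
      (fun s => EqFrom.refl s _) (shift_concat_eqFrom hT _ _)]
  rw [sub_le_iff_le_add]
  refine (ciInf_le ⟨-max C C, forall_mem_range.2 fun u =>
    (abs_le.1 (abs_backupCost_le hγ hT hC hVC x u (ξ.1 u))).1⟩ u).trans ?_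
  change max _ _ ≤ _
  rw [← hy]
  have h1 : valueFunction f U D h γ y - ε ≤ tailCost f h γ y (shift hT u) ((η y).1 (shift hT u)) :=
    (hη y).le.trans (ciInf_le ⟨-C, forall_mem_range.2 fun u => (abs_le.1 (hJ y (η y) u)).1⟩ _)
  have h2 : Real.exp (-(γ * T)) * valueFunction f U D h γ y ≤ Real.exp (-(γ * T)) *
      tailCost f h γ y (shift hT u) ((η y).1 (shift hT u)) + ε := by
    have h3 := mul_le_mul_of_nonneg_left h1 (Real.exp_pos (-(γ * T))).le
    rw [mul_sub] at h3
    linarith [mul_le_of_le_one_left hε.le hE]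
  refine max_le ?_ (h2.trans ?_)
  · exact (le_max_left _ _).trans (by linarith)
  · gcongr
    exact le_max_right _ _

/-- The dynamic programming principle. -/
theorem bellmanBackup_valueFunction (hU : IsCompact U) (hU' : U.Nonempty) (hD : IsCompact D)
    (hD' : D.Nonempty) (hf : DynamicsAssumption f U D) (hγ : 0 < γ) (hT : 0 ≤ T)
    (hC : ∀ x, |h x| ≤ C) :
    bellmanBackup f U D h γ T (valueFunction f U D h γ) = valueFunction f U D h γ :=
  funext fun x => le_antisymm
    (bellmanBackup_le_valueFunction hU hU' hD hD' hf hγ hT hC x)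
    (valueFunction_le_bellmanBackup hU hU' hD hD' hf hγ hT hC x)

/-! ### Contraction and regularity of the backup operator. -/

theorem abs_bellmanBackup_sub_le (hU' : U.Nonempty) (hD' : D.Nonempty) (hγ : 0 < γ)
    (hT : 0 ≤ T) (hC : ∀ x, |h x| ≤ C) {V W : EuclideanSpace ℝ (Fin n) → ℝ} {CV CW K : ℝ}
    (hV : ∀ x, |V x| ≤ CV) (hW : ∀ x, |W x| ≤ CW) (hK : ∀ x, |V x - W x| ≤ K)
    (x : EuclideanSpace ℝ (Fin n)) :
    |bellmanBackup f U D h γ T V x - bellmanBackup f U D h γ T W x| ≤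
      Real.exp (-(γ * T)) * K := by
  have := BackwardSignal.nonempty hU'
  have := BackwardStrategy.nonempty (A := U) hD'
  rw [bellmanBackup_eq, bellmanBackup_eq]
  refine abs_iSup_iInf_sub_le (fun ξ u => abs_backupCost_le hγ hT hC hV x u (ξ.1 u))
    (fun ξ u => abs_backupCost_le hγ hT hC hW x u (ξ.1 u)) fun ξ u => ?_
  refine (abs_max_sub_max_le_max _ _ _ _).trans (max_le ?_ ?_)
  · rw [sub_self, abs_zero]
    exact mul_nonneg (Real.exp_pos _).le ((abs_nonneg _).trans (hK x))
  · rw [← mul_sub, abs_mul, Real.abs_exp]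
    exact mul_le_mul_of_nonneg_left (hK _) (Real.exp_pos _).le

theorem dist_backwardTrajectory_le (hU : IsCompact U) (hD : IsCompact D)
    (hf : DynamicsAssumption f U D) {L : ℝ≥0}
    (hL : ∀ u ∈ U, ∀ d ∈ D, LipschitzWith L (fun x => f x u d)) (u : BackwardSignal U)
    (d : BackwardSignal D) (x y : EuclideanSpace ℝ (Fin n)) {t : ℝ} (ht : t ∈ Icc (-T) 0) :
    dist (backwardTrajectory f u.1 d.1 x t) (backwardTrajectory f u.1 d.1 y t) ≤
      dist x y * ((L + 1) * Real.exp ((L + 1) * T)) := by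
  have hL0 : (0 : ℝ) ≤ L := L.2
  have h3 := (isBackwardTrajectory_backwardTrajectory hU hD hf u d x).norm_sub_le hL u.2 d.2
    (isBackwardTrajectory_backwardTrajectory hU hD hf u d y) (EqFrom.refl (-T) u)
    (EqFrom.refl (-T) d) ht
  rw [← dist_eq_norm, ← dist_eq_norm] at h3
  have h4 : Real.exp (-((L + 1) * t)) ≤ Real.exp ((L + 1) * T) :=
    Real.exp_le_exp.2 (by nlinarith [ht.1])
  calc _ ≤ (L + 1) * dist x y * Real.exp (-((L + 1) * t)) := h3
    _ ≤ (L + 1) * dist x y * Real.exp ((L + 1) * T) := by gcongr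
    _ = _ := by ring

theorem abs_backupCost_sub_le (hγ : 0 < γ) (hT : 0 ≤ T) (hC : ∀ x, |h x| ≤ C)
    {V : EuclideanSpace ℝ (Fin n) → ℝ} {x y : EuclideanSpace ℝ (Fin n)} {u : BackwardSignal U}
    {d : BackwardSignal D} {ε : ℝ}
    (hh : ∀ t ∈ Icc (-T) 0, |h (backwardTrajectory f u.1 d.1 x t) -
      h (backwardTrajectory f u.1 d.1 y t)| ≤ ε)
    (hV : |V (backwardTrajectory f u.1 d.1 x (-T)) -
      V (backwardTrajectory f u.1 d.1 y (-T))| ≤ ε) :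
    |backupCost f h γ T V x u d - backupCost f h γ T V y u d| ≤ ε := by
  have : Nonempty (Icc (-T) (0 : ℝ)) := ⟨⟨0, by simpa using hT, le_rfl⟩⟩
  refine (abs_max_sub_max_le_max _ _ _ _).trans (max_le ?_ ?_)
  · refine abs_iSup_sub_iSup_le (fun t => abs_exp_mul_le hγ t.2.2 (hC _))
      (fun t => abs_exp_mul_le hγ t.2.2 (hC _)) fun t => ?_
    rw [← mul_sub]
    exact abs_exp_mul_le hγ t.2.2 (hh t t.2)
  · rw [← mul_sub, ← mul_neg]
    exact abs_exp_mul_le hγ (by linarith) hV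

/-- Strategies see only the control, not the terminal state, so the games from `x` and `y` can be
compared pair by pair `(ξ, u)` with identical signals. The modulus is then uniform over all pairs.
-/
theorem isBUC_bellmanBackup (hU : IsCompact U) (hU' : U.Nonempty) (hD : IsCompact D)
    (hD' : D.Nonempty) (hf : DynamicsAssumption f U D) (hγ : 0 < γ) (hT : 0 ≤ T)
    (hh : IsBUC h) {V : EuclideanSpace ℝ (Fin n) → ℝ} (hV : IsBUC V) :
    IsBUC (bellmanBackup f U D h γ T V) := by
  have := BackwardSignal.nonempty hU'
  have := BackwardStrategy.nonempty (A := U) hD'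
  obtain ⟨⟨C, hC⟩, hhu⟩ := hh
  obtain ⟨⟨C', hC'⟩, hVu⟩ := hV
  obtain ⟨L, hL⟩ := hf.lipschitz
  have hcost := fun (x : EuclideanSpace ℝ (Fin n)) (ξ : BackwardStrategy U D)
    (u : BackwardSignal U) => abs_backupCost_le (f := f) hγ hT hC hC' x u (ξ.1 u)
  refine ⟨⟨max C C', fun x => ?_⟩, ?_⟩
  · rw [bellmanBackup_eq]
    exact abs_iSup_iInf_le (hcost x)
  rw [Metric.uniformContinuous_iff] at hhu hVu ⊢
  intro ε hε
  obtain ⟨δ₁, hδ₁, h₁⟩ := hhu (ε / 2) (half_pos hε)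
  obtain ⟨δ₂, hδ₂, h₂⟩ := hVu (ε / 2) (half_pos hε)
  have hK0 : 0 < ((L : ℝ) + 1) * Real.exp ((L + 1) * T) := by positivity
  refine ⟨min δ₁ δ₂ / ((L + 1) * Real.exp ((L + 1) * T)), div_pos (lt_min hδ₁ hδ₂) hK0,
    fun {x y} hxy => ?_⟩
  rw [lt_div_iff₀ hK0] at hxy
  rw [Real.dist_eq, bellmanBackup_eq, bellmanBackup_eq]
  refine (abs_iSup_iInf_sub_le (ε := ε / 2) (hcost x) (hcost y) fun ξ u => ?_).trans_lt
    (half_lt_self hε)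
  have hclose := fun (t : ℝ) (ht : t ∈ Icc (-T) 0) =>
    (dist_backwardTrajectory_le hU hD hf hL u (ξ.1 u) x y ht).trans_lt hxy
  refine abs_backupCost_sub_le hγ hT hC (fun t ht => ?_) ?_
  · rw [← Real.dist_eq]
    exact (h₁ ((hclose t ht).trans_le (min_le_left _ _))).le
  · rw [← Real.dist_eq]
    exact (h₂ ((hclose (-T) ⟨le_rfl, by linarith⟩).trans_le (min_le_right _ _))).le

theorem supNorm_nonneg (V : EuclideanSpace ℝ (Fin n) → ℝ) : 0 ≤ supNorm V :=
  Real.iSup_nonneg fun _ => abs_nonneg _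

/-- Boundedness is essential: `supNorm` of an unbounded function is the default value `0`. -/
theorem abs_sub_le_supNorm {V W : EuclideanSpace ℝ (Fin n) → ℝ} {CV CW : ℝ}
    (hV : ∀ x, |V x| ≤ CV) (hW : ∀ x, |W x| ≤ CW) (x : EuclideanSpace ℝ (Fin n)) :
    |V x - W x| ≤ supNorm (V - W) :=
  le_ciSup (f := fun x => |(V - W) x|) ⟨CV + CW, forall_mem_range.2 fun x =>
    (abs_sub _ _).trans (add_le_add (hV x) (hW x))⟩ x

end Game

end FRT

/-! ### Value iteration. -/

theorem mainTheorem12 {n m p : ℕ}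
    (U : Set (EuclideanSpace ℝ (Fin m))) (D : Set (EuclideanSpace ℝ (Fin p)))
    (hU : IsCompact U) (hU' : U.Nonempty) (hD : IsCompact D) (hD' : D.Nonempty)
    (f : EuclideanSpace ℝ (Fin n) → EuclideanSpace ℝ (Fin m) → EuclideanSpace ℝ (Fin p) →
      EuclideanSpace ℝ (Fin n))
    (hf : FRT.DynamicsAssumption f U D)
    (h : EuclideanSpace ℝ (Fin n) → ℝ) (hh : FRT.IsBUC h)
    (γ : ℝ) (hγ : 0 < γ) (Δt : ℝ) (hΔt : 0 < Δt)
    (V : ℕ → EuclideanSpace ℝ (Fin n) → ℝ) (hV0 : FRT.IsBUC (V 0))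
    (hV : ∀ k, V (k + 1) = FRT.bellmanBackup f U D h γ Δt (V k)) :
    FRT.IsBUC (FRT.valueFunction f U D h γ) ∧ (∀ k, FRT.IsBUC (V k)) ∧
    Real.exp (-(γ * Δt)) < 1 ∧
    (∀ k, FRT.supNorm (V (k + 1) - FRT.valueFunction f U D h γ) ≤
      Real.exp (-(γ * Δt)) * FRT.supNorm (V k - FRT.valueFunction f U D h γ)) ∧
    Filter.Tendsto (fun k => FRT.supNorm (V k - FRT.valueFunction f U D h γ))
      Filter.atTop (nhds 0) := by
  have := FRT.BackwardSignal.nonempty hU'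
  have := FRT.BackwardStrategy.nonempty (A := U) hD'
  obtain ⟨C, hC⟩ := hh.1
  -- Boundedness of the value function is all that the contraction estimate and the fixed point
  -- property require, so deriving its uniform continuity from convergence is not circular.
  have hW : ∀ x, |FRT.valueFunction f U D h γ x| ≤ C := fun x => by
    rw [FRT.valueFunction_eq]
    exact FRT.abs_iSup_iInf_le fun ξ u => FRT.abs_tailCost_le hγ hC x u (ξ.1 u)
  have hVk : ∀ k, FRT.IsBUC (V k) := by
    intro k
    induction k with
    | zero => exact hV0
    | succ k ih => rw [hV k]; exact FRT.isBUC_bellmanBackup hU hU' hD hD' hf hγ hΔt.le hh ih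
  have hlt : Real.exp (-(γ * Δt)) < 1 := Real.exp_lt_one_iff.2 (by linarith [mul_pos hγ hΔt])
  have hle : ∀ k x, |V k x - FRT.valueFunction f U D h γ x| ≤
      FRT.supNorm (V k - FRT.valueFunction f U D h γ) := fun k =>
    (hVk k).1.elim fun C' hC' => FRT.abs_sub_le_supNorm hC' hW
  have hcontr : ∀ k, FRT.supNorm (V (k + 1) - FRT.valueFunction f U D h γ) ≤
      Real.exp (-(γ * Δt)) * FRT.supNorm (V k - FRT.valueFunction f U D h γ) := by
    intro k
    obtain ⟨C', hC'⟩ := (hVk k).1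
    refine ciSup_le fun x => ?_
    have h1 := FRT.abs_bellmanBackup_sub_le (f := f) hU' hD' hγ hΔt.le hC hC' hW (hle k) x
    rwa [FRT.bellmanBackup_valueFunction hU hU' hD hD' hf hγ hΔt.le hC, ← hV k] at h1
  have hpow : ∀ k, FRT.supNorm (V k - FRT.valueFunction f U D h γ) ≤
      Real.exp (-(γ * Δt)) ^ k * FRT.supNorm (V 0 - FRT.valueFunction f U D h γ) := by
    intro k
    induction k with
    | zero => simp
    | succ k ih =>
      refine (hcontr k).trans ?_
      rw [pow_succ', mul_assoc]
      exact mul_le_mul_of_nonneg_left ih (Real.exp_pos _).le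
  have htend : Tendsto (fun k => FRT.supNorm (V k - FRT.valueFunction f U D h γ))
      atTop (𝓝 0) := by
    refine squeeze_zero (fun k => FRT.supNorm_nonneg _) hpow ?_
    simpa using (tendsto_pow_atTop_nhds_zero_of_lt_one (Real.exp_pos _).le hlt).mul_const
      (FRT.supNorm (V 0 - FRT.valueFunction f U D h γ))
  -- Convergence in sup norm is uniform convergence, which passes uniform continuity from the
  -- iterates to the value function.
  have hunif : TendstoUniformly V (FRT.valueFunction f U D h γ) atTop := by
    rw [Metric.tendstoUniformly_iff]
    intro ε hε
    filter_upwards [htend.eventually (gt_mem_nhds hε)] with k hk x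
    rw [dist_comm, Real.dist_eq]
    exact (hle k x).trans_lt hk
  exact ⟨⟨⟨C, hW⟩, hunif.uniformContinuous (Frequently.of_forall fun k => (hVk k).2)⟩,
    hVk, hlt, hcontr, htend⟩
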